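/- For $q\neq 1$ let $\log_q x=\frac{x^{q-1}-1}{q-1}$ $(x>0)$ be the deformed logarithm, and for $q>1$ let $\exp_q x=\bigl((q-1)x+1\bigr)^{1/(q-1)}$ $\bigl(x>-\tfrac1{q-1}\bigr)$ be the deformed exponential; they are applied to Hermitian matrices with spectrum in the respective domain by the functional calculus. Let $H$ be a complex $m\times n$ matrix that is a contraction (its operator norm with respect to the Euclidean norms is at most $1$), let $L$ be a positive definite complex $n\times n$ matrix, and let $q,r\in[2,3]$ with $r\ge q$. Then for every positive definite complex $m\times m$ matrix $A$ the matrix $L+H^*\log_r(A)H$ is Hermitian with spectrum in $\bigl(-\tfrac1{q-1},\infty\bigr)$, so that $\exp_q\bigl(L+H^*\log_r(A)H\bigr)$ is well defined, and the map $$A\mapsto \operatorname{Tr}\exp_q\bigl(L+H^*\log_r(A)\,H\bigr)$$ is convex on the set of positive definite complex $m\times m$ matrices. -/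

import Mathlib

open scoped Matrix ComplexOrder

noncomputable section

/-- The deformed logarithm `log_q`; the formula is meaningful for `x > 0`. -/
def deformedLog (q x : ℝ) : ℝ :=
  if q = 1 then Real.log x else (x ^ (q - 1) - 1) / (q - 1)

/-- The domain of the deformed exponential: `(-1/(q-1), ∞)` for `q > 1`, `(-∞, -1/(q-1))` for
`q < 1`, and the whole real line for `q = 1`. -/
def deformedExpDomain (q : ℝ) : Set ℝ :=
  {x | (1 < q → -1 / (q - 1) < x) ∧ (q < 1 → x < -1 / (q - 1))}

/-- The deformed exponential `exp_q`; the formula is meaningful on `deformedExpDomain q`, where it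
is the inverse function of `log_q`. -/
def deformedExp (q x : ℝ) : ℝ :=
  if q = 1 then Real.exp x else (x * (q - 1) + 1) ^ (1 / (q - 1))

/-- The deformed logarithm of a Hermitian matrix, by the functional calculus. -/
def matrixLog {n : Type*} [Fintype n] [DecidableEq n] (q : ℝ) (A : Matrix n n ℂ) :
    Matrix n n ℂ :=
  cfc (deformedLog q) A

/-- The deformed exponential of a Hermitian matrix, by the functional calculus. -/
def matrixExp {n : Type*} [Fintype n] [DecidableEq n] (q : ℝ) (A : Matrix n n ℂ) :
    Matrix n n ℂ :=
  cfc (deformedExp q) A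

open scoped Matrix.Norms.L2Operator in
/-- A matrix is a contraction if its operator norm with respect to the Euclidean norms is at
most one. -/
def IsContraction {m n : Type*} [Fintype m] [Fintype n] [DecidableEq n] (H : Matrix m n ℂ) :
    Prop :=
  ‖H‖ ≤ 1

end

set_option linter.unusedSectionVars false


/-! Put `s = r - 1`, `t = 1 / (q - 1)` and `c = (q - 1) / (r - 1)`. Then `exp_q` of the given
argument is `(C + c H* A^s H)^t` with `C = (q - 1) L + 1 - c H*H`, which is positive definite
because `H` is a contraction and `c ≤ 1`. So the claim reduces to a Carlen–Lieb type theorem,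
`trace_rpow_add_conj_rpow_convex`, under `1 ≤ s ≤ 2` and `1/s ≤ t ≤ 1`.

For `t < 1` and `s > 1` that theorem rests on a variational formula: `Tr X^t` is the minimum over `W
> 0` of `t Tr(X W^(1-s)) + (1 - t) Tr W^b`, where `(1 - t) b = t (s - 1)`. With `X = C + c H* A^s H`
every term is jointly convex in `(A, W)`: the power trace by Klein's inequality (`b ≥ 1`), the
others by Ando's theorem `kernelJointlyConvex_rpow`. Minimising a jointly convex function over `W`
leaves a convex function of `A`.

Ando's theorem comes from writing `x^s y^(1-s)` as an integral of kernels `x² / (x + t y)`, each of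
whose forms is a maximum of functions linear in `(A, W)`. -/

/-! ### Quadratic forms in two eigenbases. -/

/-- The entries of a rectangular matrix with respect to the eigenbases of two Hermitian
matrices. -/
noncomputable def eigenCoords {m n : Type*} [Fintype m] [DecidableEq m] [Fintype n] [DecidableEq n]
    {A : Matrix m m ℂ} {W : Matrix n n ℂ} (hA : A.IsHermitian) (hW : W.IsHermitian)
    (K : Matrix m n ℂ) : Matrix m n ℂ :=
  (hA.eigenvectorUnitary : Matrix m m ℂ)ᴴ * K * (hW.eigenvectorUnitary : Matrix n n ℂ)

/-- The quadratic form `∑ᵢⱼ h(aᵢ, wⱼ) |kᵢⱼ|²` in the eigenbases of `A` and `W`. -/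
noncomputable def kernelForm {m n : Type*} [Fintype m] [DecidableEq m] [Fintype n] [DecidableEq n]
    {A : Matrix m m ℂ} {W : Matrix n n ℂ} (hA : A.IsHermitian) (hW : W.IsHermitian)
    (h : ℝ → ℝ → ℝ) (K : Matrix m n ℂ) : ℝ :=
  ∑ i, ∑ j, h (hA.eigenvalues i) (hW.eigenvalues j) * Complex.normSq (eigenCoords hA hW K i j)

section
variable {m n : Type*} [Fintype m] [DecidableEq m] [Fintype n] [DecidableEq n]
  {A : Matrix m m ℂ} {W : Matrix n n ℂ}

theorem trace_cfc_mul_cfc (hA : A.IsHermitian) (hW : W.IsHermitian) (f g : ℝ → ℝ)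
    (Z K : Matrix m n ℂ) :
    (Zᴴ * cfc f A * K * cfc g W).trace = ∑ i, ∑ j,
      ((f (hA.eigenvalues i) * g (hW.eigenvalues j) : ℝ) : ℂ) *
        (star (eigenCoords hA hW Z i j) * eigenCoords hA hW K i j) := by
  rw [hA.cfc_eq, hW.cfc_eq, Matrix.IsHermitian.cfc, Matrix.IsHermitian.cfc,
    Unitary.conjStarAlgAut_apply, Unitary.conjStarAlgAut_apply]
  simp only [← Unitary.coe_star]
  set U : Matrix m m ℂ := (hA.eigenvectorUnitary : Matrix m m ℂ) with hU
  set V : Matrix n n ℂ := (hW.eigenvectorUnitary : Matrix n n ℂ) with hV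
  set D : Matrix m m ℂ := Matrix.diagonal (RCLike.ofReal ∘ f ∘ hA.eigenvalues)
  set E : Matrix n n ℂ := Matrix.diagonal (RCLike.ofReal ∘ g ∘ hW.eigenvalues)
  have h1 : (Zᴴ * (U * D * star U) * K * (V * E * star V)).trace
      = ((eigenCoords hA hW Z)ᴴ * D * (eigenCoords hA hW K * E)).trace := by
    have : (Zᴴ * (U * D * star U) * K * (V * E * star V))
      = (Zᴴ * U * D * star U * K * V * E) * star V := by simp only [Matrix.mul_assoc]
    rw [this, Matrix.trace_mul_comm]
    simp only [eigenCoords, Matrix.conjTranspose_mul, Matrix.conjTranspose_conjTranspose,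
      Matrix.mul_assoc, ← hU, ← hV, Matrix.star_eq_conjTranspose]
  simp only [Unitary.coe_star, ← hU, ← hV]
  rw [h1, Matrix.trace, Finset.sum_comm]
  refine Finset.sum_congr rfl fun j _ => ?_
  rw [Matrix.diag_apply, Matrix.mul_apply]
  refine Finset.sum_congr rfl fun i _ => ?_
  simp only [D, E, Matrix.mul_diagonal, Matrix.conjTranspose_apply, Function.comp_apply,
    Complex.ofReal_mul]
  simp only [RCLike.ofReal, Complex.coe_algebraMap]
  ring

theorem kernelForm_mul (hA : A.IsHermitian) (hW : W.IsHermitian) (f g : ℝ → ℝ)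
    (K : Matrix m n ℂ) :
    kernelForm hA hW (fun x y => f x * g y) K = (Kᴴ * cfc f A * K * cfc g W).trace.re := by
  rw [trace_cfc_mul_cfc hA hW, kernelForm, Complex.re_sum]
  refine Finset.sum_congr rfl fun i _ => ?_
  rw [Complex.re_sum]
  refine Finset.sum_congr rfl fun j _ => ?_
  rw [Complex.re_ofReal_mul, Complex.star_def, ← Complex.normSq_eq_conj_mul_self,
    Complex.ofReal_re]

theorem kernelForm_mono (hA : A.IsHermitian) (hW : W.IsHermitian) {h₁ h₂ : ℝ → ℝ → ℝ}
    (h : ∀ i j, h₁ (hA.eigenvalues i) (hW.eigenvalues j) ≤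
      h₂ (hA.eigenvalues i) (hW.eigenvalues j)) (K : Matrix m n ℂ) :
    kernelForm hA hW h₁ K ≤ kernelForm hA hW h₂ K :=
  Finset.sum_le_sum fun i _ => Finset.sum_le_sum fun j _ =>
    mul_le_mul_of_nonneg_right (h i j) (Complex.normSq_nonneg _)

theorem kernelForm_congr (hA : A.IsHermitian) (hW : W.IsHermitian) {h₁ h₂ : ℝ → ℝ → ℝ}
    (h : ∀ i j, h₁ (hA.eigenvalues i) (hW.eigenvalues j) =
      h₂ (hA.eigenvalues i) (hW.eigenvalues j)) (K : Matrix m n ℂ) :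
    kernelForm hA hW h₁ K = kernelForm hA hW h₂ K := by
  simp only [kernelForm, h]

theorem kernelForm_add (hA : A.IsHermitian) (hW : W.IsHermitian) (h₁ h₂ : ℝ → ℝ → ℝ)
    (K : Matrix m n ℂ) :
    kernelForm hA hW (fun x y => h₁ x y + h₂ x y) K =
      kernelForm hA hW h₁ K + kernelForm hA hW h₂ K := by
  simp only [kernelForm, add_mul, Finset.sum_add_distrib]

theorem kernelForm_const_mul (hA : A.IsHermitian) (hW : W.IsHermitian) (c : ℝ)
    (h : ℝ → ℝ → ℝ) (K : Matrix m n ℂ) :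
    kernelForm hA hW (fun x y => c * h x y) K = c * kernelForm hA hW h K := by
  simp only [kernelForm, mul_assoc, Finset.mul_sum]

open MeasureTheory in
theorem kernelForm_integral (hA : A.IsHermitian) (hW : W.IsHermitian) {μ : Measure ℝ}
    {h : ℝ → ℝ → ℝ → ℝ}
    (hint : ∀ i j, Integrable (fun t => h t (hA.eigenvalues i) (hW.eigenvalues j)) μ)
    (K : Matrix m n ℂ) :
    Integrable (fun t => kernelForm hA hW (h t) K) μ ∧
      kernelForm hA hW (fun x y => ∫ t, h t x y ∂μ) K = ∫ t, kernelForm hA hW (h t) K ∂μ := by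
  unfold kernelForm
  refine ⟨integrable_finsetSum _ fun i _ => integrable_finsetSum _ fun j _ =>
    (hint i j).mul_const _, ?_⟩
  rw [integral_finsetSum _ fun i _ => integrable_finsetSum _ fun j _ => (hint i j).mul_const _]
  refine Finset.sum_congr rfl fun i _ => ?_
  rw [integral_finsetSum _ fun j _ => (hint i j).mul_const _]
  exact Finset.sum_congr rfl fun j _ => (integral_mul_const _ _).symm

theorem exists_eigenCoords_eq (hA : A.IsHermitian) (hW : W.IsHermitian) (M : Matrix m n ℂ) :
    ∃ Z, eigenCoords hA hW Z = M := by
  refine ⟨(hA.eigenvectorUnitary : Matrix m m ℂ) * M * (hW.eigenvectorUnitary : Matrix n n ℂ)ᴴ, ?_⟩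
  have h1 : (hA.eigenvectorUnitary : Matrix m m ℂ)ᴴ * (hA.eigenvectorUnitary : Matrix m m ℂ) = 1 :=
    Unitary.coe_star_mul_self _
  have h2 : (hW.eigenvectorUnitary : Matrix n n ℂ)ᴴ * (hW.eigenvectorUnitary : Matrix n n ℂ) = 1 :=
    Unitary.coe_star_mul_self _
  simp only [eigenCoords, Matrix.mul_assoc, h2, Matrix.mul_one]
  rw [← Matrix.mul_assoc, h1, Matrix.one_mul]

/-! ### Joint convexity and Ando's theorem. -/

/-- The affine minorants, indexed by `Z`, of the form with kernel `x² / (a x + b y)`. -/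
noncomputable def quadraticMinorant (a b : ℝ) (A : Matrix m m ℂ) (W : Matrix n n ℂ)
    (K Z : Matrix m n ℂ) : ℝ :=
  2 * (Zᴴ * A * K).trace.re - a * (Zᴴ * A * Z).trace.re - b * (Zᴴ * Z * W).trace.re

theorem quadraticMinorant_eq_sum (hA : A.IsHermitian) (hW : W.IsHermitian) (a b : ℝ)
    (K Z : Matrix m n ℂ) :
    quadraticMinorant a b A W K Z = ∑ i, ∑ j,
      (2 * hA.eigenvalues i * (star (eigenCoords hA hW Z i j) * eigenCoords hA hW K i j).re -
        (a * hA.eigenvalues i + b * hW.eigenvalues j) *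
          Complex.normSq (eigenCoords hA hW Z i j)) := by
  have hA' : IsSelfAdjoint A := hA
  have hW' : IsSelfAdjoint W := hW
  have e1 : (Zᴴ * A * K).trace = (Zᴴ * cfc (fun x : ℝ => x) A * K * cfc (fun _ => (1 : ℝ)) W).trace := by
    rw [cfc_id' ℝ A, cfc_const_one ℝ W, Matrix.mul_one]
  have e2 : (Zᴴ * A * Z).trace = (Zᴴ * cfc (fun x : ℝ => x) A * Z * cfc (fun _ => (1 : ℝ)) W).trace := by
    rw [cfc_id' ℝ A, cfc_const_one ℝ W, Matrix.mul_one]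
  have e3 : (Zᴴ * Z * W).trace = (Zᴴ * cfc (fun _ => (1 : ℝ)) A * Z * cfc (fun x : ℝ => x) W).trace := by
    rw [cfc_id' ℝ W, cfc_const_one ℝ A, Matrix.mul_one]
  rw [quadraticMinorant, e1, e2, e3, ← kernelForm_mul hA hW, ← kernelForm_mul hA hW,
    trace_cfc_mul_cfc hA hW, Complex.re_sum]
  simp only [kernelForm, Complex.re_sum, Finset.mul_sum, ← Finset.sum_sub_distrib,
    Complex.re_ofReal_mul]
  refine Finset.sum_congr rfl fun i _ => Finset.sum_congr rfl fun j _ => ?_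
  ring

/-- Completing the square: the gap, multiplied by `c`, is `|c z - x k|²`. -/
theorem Complex.two_mul_re_sub_le {c x : ℝ} (hc : 0 < c) (z k : ℂ) :
    2 * x * (star z * k).re - c * Complex.normSq z ≤ x ^ 2 / c * Complex.normSq k := by
  have h := Complex.normSq_nonneg ((c : ℂ) * z - x * k)
  have h2 : Complex.normSq ((c : ℂ) * z - x * k) =
      c * (x ^ 2 / c * Complex.normSq k - (2 * x * (star z * k).re - c * Complex.normSq z)) := by
    simp only [Complex.normSq_apply, Complex.star_def, Complex.sub_re, Complex.sub_im,
      Complex.mul_re, Complex.mul_im, Complex.ofReal_re, Complex.ofReal_im, Complex.conj_re,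
      Complex.conj_im]
    field_simp
    ring
  rw [h2] at h
  linarith [nonneg_of_mul_nonneg_right h hc]

theorem quadraticMinorant_le (hA : A.PosDef) (hW : W.PosDef) {a b : ℝ} (ha : 0 ≤ a) (hb : 0 < b)
    (K Z : Matrix m n ℂ) :
    quadraticMinorant a b A W K Z ≤
      kernelForm hA.isHermitian hW.isHermitian (fun x y => x ^ 2 / (a * x + b * y)) K := by
  rw [quadraticMinorant_eq_sum hA.isHermitian hW.isHermitian]
  refine Finset.sum_le_sum fun i _ => Finset.sum_le_sum fun j _ => ?_
  have := hA.eigenvalues_pos i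
  have := hW.eigenvalues_pos j
  exact Complex.two_mul_re_sub_le (by positivity) _ _

theorem exists_quadraticMinorant_eq (hA : A.PosDef) (hW : W.PosDef) {a b : ℝ} (ha : 0 ≤ a)
    (hb : 0 < b) (K : Matrix m n ℂ) :
    ∃ Z, quadraticMinorant a b A W K Z =
      kernelForm hA.isHermitian hW.isHermitian (fun x y => x ^ 2 / (a * x + b * y)) K := by
  -- Entrywise equality case `z = x k / c` of the completed square, with `c = a x + b y`.
  obtain ⟨Z, hZ⟩ := exists_eigenCoords_eq hA.isHermitian hW.isHermitian (Matrix.of fun i j =>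
    ((hA.isHermitian.eigenvalues i / (a * hA.isHermitian.eigenvalues i + b * hW.isHermitian.eigenvalues j) : ℝ) : ℂ) *
      eigenCoords hA.isHermitian hW.isHermitian K i j)
  refine ⟨Z, ?_⟩
  rw [quadraticMinorant_eq_sum hA.isHermitian hW.isHermitian]
  refine Finset.sum_congr rfl fun i _ => Finset.sum_congr rfl fun j _ => ?_
  have h1 := hA.eigenvalues_pos i
  have h2 := hW.eigenvalues_pos j
  have h3 : a * hA.isHermitian.eigenvalues i + b * hW.isHermitian.eigenvalues j ≠ 0 := by positivity
  rw [hZ, Matrix.of_apply, Complex.star_def, map_mul, Complex.conj_ofReal,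
    mul_assoc (Complex.ofReal _),
    ← Complex.normSq_eq_conj_mul_self, ← Complex.ofReal_mul, Complex.ofReal_re, Complex.normSq_mul,
    Complex.normSq_ofReal]
  field_simp
  ring

/-- Joint convexity on pairs of positive definite matrices of the form with a given kernel. -/
def KernelJointlyConvex (m n : Type*) [Fintype m] [DecidableEq m] [Fintype n] [DecidableEq n]
    (h : ℝ → ℝ → ℝ) : Prop :=
  ∀ (K : Matrix m n ℂ) ⦃A₁ A₂ A : Matrix m m ℂ⦄ ⦃W₁ W₂ W : Matrix n n ℂ⦄ (hA₁ : A₁.PosDef)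
    (hA₂ : A₂.PosDef) (hA : A.PosDef) (hW₁ : W₁.PosDef) (hW₂ : W₂.PosDef) (hW : W.PosDef)
    ⦃c₁ c₂ : ℝ⦄, 0 ≤ c₁ → 0 ≤ c₂ → A = c₁ • A₁ + c₂ • A₂ →
    W = c₁ • W₁ + c₂ • W₂ →
    kernelForm hA.isHermitian hW.isHermitian h K ≤ c₁ * kernelForm hA₁.isHermitian hW₁.isHermitian h K + c₂ * kernelForm hA₂.isHermitian hW₂.isHermitian h K

/-- The maximiser `Z` at the combined pair is a competitor at both given pairs. The minorants are
linear in `(A, W)`, so the weights need not sum to one. -/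
theorem kernelJointlyConvex_sq_div {a b : ℝ} (ha : 0 ≤ a) (hb : 0 < b) :
    KernelJointlyConvex m n (fun x y => x ^ 2 / (a * x + b * y)) := by
  intro K A₁ A₂ A W₁ W₂ W hA₁ hA₂ hA hW₁ hW₂ hW c₁ c₂ h₁ h₂ eA eW
  obtain ⟨Z, hZ⟩ := exists_quadraticMinorant_eq hA hW ha hb K
  rw [← hZ]
  have e : quadraticMinorant a b A W K Z =
      c₁ * quadraticMinorant a b A₁ W₁ K Z + c₂ * quadraticMinorant a b A₂ W₂ K Z := by
    subst eA eW
    simp only [quadraticMinorant, Matrix.mul_add, Matrix.add_mul, Matrix.mul_smul, Matrix.smul_mul,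
      Matrix.trace_add, Matrix.trace_smul, Complex.add_re, Complex.smul_re, smul_eq_mul]
    ring
  rw [e]
  gcongr
  · exact quadraticMinorant_le hA₁ hW₁ ha hb K Z
  · exact quadraticMinorant_le hA₂ hW₂ ha hb K Z

theorem KernelJointlyConvex.congr {h h' : ℝ → ℝ → ℝ} (hh : KernelJointlyConvex m n h)
    (e : ∀ x y, 0 < x → 0 < y → h' x y = h x y) : KernelJointlyConvex m n h' := by
  intro K A₁ A₂ A W₁ W₂ W hA₁ hA₂ hA hW₁ hW₂ hW c₁ c₂ h₁ h₂ eA eW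
  rw [kernelForm_congr hA.isHermitian hW.isHermitian (fun i j => e _ _ (hA.eigenvalues_pos i) (hW.eigenvalues_pos j)),
    kernelForm_congr hA₁.isHermitian hW₁.isHermitian
      (fun i j => e _ _ (hA₁.eigenvalues_pos i) (hW₁.eigenvalues_pos j)),
    kernelForm_congr hA₂.isHermitian hW₂.isHermitian
      (fun i j => e _ _ (hA₂.eigenvalues_pos i) (hW₂.eigenvalues_pos j))]
  exact hh K hA₁ hA₂ hA hW₁ hW₂ hW h₁ h₂ eA eW

theorem KernelJointlyConvex.const_mul {h : ℝ → ℝ → ℝ} (hh : KernelJointlyConvex m n h) {c : ℝ}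
    (hc : 0 ≤ c) : KernelJointlyConvex m n (fun x y => c * h x y) := by
  intro K A₁ A₂ A W₁ W₂ W hA₁ hA₂ hA hW₁ hW₂ hW c₁ c₂ h₁ h₂ eA eW
  simp only [kernelForm_const_mul]
  have := mul_le_mul_of_nonneg_left (hh K hA₁ hA₂ hA hW₁ hW₂ hW h₁ h₂ eA eW) hc
  linarith

open MeasureTheory in
theorem KernelJointlyConvex.integral {μ : Measure ℝ} {h : ℝ → ℝ → ℝ → ℝ}
    (hint : ∀ x y, 0 < x → 0 < y → Integrable (fun t => h t x y) μ)
    (hh : ∀ᵐ t ∂μ, KernelJointlyConvex m n (h t)) :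
    KernelJointlyConvex m n (fun x y => ∫ t, h t x y ∂μ) := by
  intro K A₁ A₂ A W₁ W₂ W hA₁ hA₂ hA hW₁ hW₂ hW c₁ c₂ h₁ h₂ eA eW
  obtain ⟨i0, e0⟩ := kernelForm_integral hA.isHermitian hW.isHermitian
    (fun i j => hint _ _ (hA.eigenvalues_pos i) (hW.eigenvalues_pos j)) K
  obtain ⟨i1, e1⟩ := kernelForm_integral hA₁.isHermitian hW₁.isHermitian
    (fun i j => hint _ _ (hA₁.eigenvalues_pos i) (hW₁.eigenvalues_pos j)) K
  obtain ⟨i2, e2⟩ := kernelForm_integral hA₂.isHermitian hW₂.isHermitian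
    (fun i j => hint _ _ (hA₂.eigenvalues_pos i) (hW₂.eigenvalues_pos j)) K
  rw [e0, e1, e2, ← integral_const_mul, ← integral_const_mul,
    ← integral_add (i1.const_mul _) (i2.const_mul _)]
  refine integral_mono_ae i0 ((i1.const_mul _).add (i2.const_mul _)) ?_
  filter_upwards [hh] with t ht
  exact ht K hA₁ hA₂ hA hW₁ hW₂ hW h₁ h₂ eA eW

theorem kernelJointlyConvex_left : KernelJointlyConvex m n (fun x _ => x) := by
  intro K A₁ A₂ A W₁ W₂ W hA₁ hA₂ hA hW₁ hW₂ hW c₁ c₂ h₁ h₂ eA eW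
  have key : ∀ {B : Matrix m m ℂ} {V : Matrix n n ℂ} (hB : B.IsHermitian) (hV : V.IsHermitian),
      kernelForm hB hV (fun x _ => x) K = (Kᴴ * B * K).trace.re := by
    intro B V hB hV
    have h := kernelForm_mul hB hV (fun x => x) (fun _ => 1) K
    have hB' : IsSelfAdjoint B := hB
    have hV' : IsSelfAdjoint V := hV
    rw [cfc_id' ℝ B, cfc_const_one ℝ V, Matrix.mul_one] at h
    simpa only [mul_one] using h
  rw [key, key, key]
  subst eA
  simp [Matrix.mul_add, Matrix.add_mul]

/-- Ando's convexity theorem, for `A ^ s ⊗ W ^ (1 - s)` with `1 ≤ s ≤ 2`. -/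
theorem kernelJointlyConvex_rpow {s : ℝ} (hs : s ∈ Set.Icc (1 : ℝ) 2) :
    KernelJointlyConvex m n (fun x y => x ^ s * y ^ (1 - s)) := by
  -- The integral representation needs an exponent `s - 1` strictly between 0 and 1, so both
  -- endpoints are separate.
  rcases hs.1.eq_or_lt with rfl | h1
  · exact kernelJointlyConvex_left.congr fun x y _ _ => by simp
  rcases hs.2.eq_or_lt with rfl | h2
  · refine (kernelJointlyConvex_sq_div (a := 0) (b := 1) le_rfl one_pos).congr fun x y hx hy => ?_
    norm_num [Real.rpow_neg_one]
    rfl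
  have hp : s - 1 ∈ Set.Ioo (0 : ℝ) 1 := ⟨by linarith, by linarith⟩
  obtain ⟨μ, hμ⟩ := Real.exists_measure_rpow_eq_integral_rpowIntegrand₀₁ hp
  have hmem : ∀ x y : ℝ, 0 < x → 0 < y → x / y ∈ Set.Ici (0 : ℝ) := fun x y hx hy =>
    (div_pos hx hy).le
  -- `x^s y^(1-s) = x (x/y)^(s-1)`; the integrand times `x` is `t^(s-2) x² / (x + t y)`.
  refine (KernelJointlyConvex.integral (μ := μ.restrict (Set.Ioi 0))
    (h := fun t x y => x * Real.rpowIntegrand₀₁ (s - 1) t (x / y))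
    (fun x y hx hy => (hμ _ (hmem x y hx hy)).1.const_mul _) ?_).congr fun x y hx hy => ?_
  · filter_upwards [MeasureTheory.ae_restrict_mem measurableSet_Ioi] with t ht
    have ht : 0 < t := ht
    refine ((kernelJointlyConvex_sq_div (a := 1) (b := t) zero_le_one ht).const_mul
      (c := t ^ (s - 1 - 1)) (by positivity)).congr fun x y hx hy => ?_
    rw [Real.rpowIntegrand₀₁_eq_pow_div hp ht.le (hmem x y hx hy)]
    field_simp
    ring
  · rw [MeasureTheory.integral_const_mul, ← (hμ _ (hmem x y hx hy)).2,
      Real.div_rpow hx.le hy.le, show (1 - s) = -(s - 1) by ring, Real.rpow_neg hy.le,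
      Real.rpow_sub hx, Real.rpow_one]
    field_simp


/-! ### Trace inequalities and the variational formula for `Tr X^t`. -/

theorem Matrix.continuousOn_spectrum (A : Matrix n n ℂ) (f : ℝ → ℝ) :
    ContinuousOn f (spectrum ℝ A) :=
  A.finite_real_spectrum.continuousOn f

theorem Matrix.PosDef.spectrum_pos {A : Matrix n n ℂ} (hA : A.PosDef) {x : ℝ}
    (hx : x ∈ spectrum ℝ A) : 0 < x := by
  rw [hA.isHermitian.spectrum_real_eq_range_eigenvalues] at hx
  obtain ⟨i, rfl⟩ := hx
  exact hA.eigenvalues_pos i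

theorem Matrix.posDef_of_spectrum_pos {A : Matrix n n ℂ} (hA : A.IsHermitian)
    (h : ∀ x ∈ spectrum ℝ A, 0 < x) : A.PosDef :=
  hA.posDef_iff_eigenvalues_pos.2 fun i => h _ (hA.eigenvalues_mem_spectrum_real i)

theorem Matrix.posDef_cfc {A : Matrix n n ℂ} (hA : A.IsHermitian) {f : ℝ → ℝ}
    (hf : ∀ x ∈ spectrum ℝ A, 0 < f x) : (cfc f A).PosDef := by
  have hA' : IsSelfAdjoint A := hA
  refine Matrix.posDef_of_spectrum_pos (cfc_predicate f A : IsSelfAdjoint _) ?_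
  rw [cfc_map_spectrum f A hA' (A.continuousOn_spectrum f)]
  rintro _ ⟨x, hx, rfl⟩
  exact hf x hx

/-- Taking `K = 1` lets `kernelForm_mono` transfer scalar inequalities in `x, y` to traces of
noncommuting matrices. -/
theorem kernelForm_one {X Y : Matrix n n ℂ} (hX : X.IsHermitian) (hY : Y.IsHermitian)
    (f g : ℝ → ℝ) :
    kernelForm hX hY (fun x y => f x * g y) 1 = (cfc f X * cfc g Y).trace.re := by
  rw [kernelForm_mul, Matrix.conjTranspose_one, Matrix.one_mul, Matrix.mul_one]

theorem kernelForm_one_left {X Y : Matrix n n ℂ} (hX : X.IsHermitian) (hY : Y.IsHermitian)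
    (f : ℝ → ℝ) :
    kernelForm hX hY (fun x _ => f x) 1 = (cfc f X).trace.re := by
  have hY' : IsSelfAdjoint Y := hY
  simpa [cfc_const_one ℝ Y hY'] using kernelForm_one hX hY f (fun _ => 1)

theorem kernelForm_one_right {X Y : Matrix n n ℂ} (hX : X.IsHermitian) (hY : Y.IsHermitian)
    (g : ℝ → ℝ) :
    kernelForm hX hY (fun _ y => g y) 1 = (cfc g Y).trace.re := by
  have hX' : IsSelfAdjoint X := hX
  simpa [cfc_const_one ℝ X hX'] using kernelForm_one hX hY (fun _ => 1) g

theorem kernelForm_one_id_left {X Y : Matrix n n ℂ} (hX : X.IsHermitian) (hY : Y.IsHermitian)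
    (g : ℝ → ℝ) :
    kernelForm hX hY (fun x y => x * g y) 1 = (X * cfc g Y).trace.re := by
  have hX' : IsSelfAdjoint X := hX
  rw [kernelForm_one hX hY (fun x => x) g, cfc_id' ℝ X hX']

/-- Bernoulli's inequality at `x / y - 1`, scaled by `y^b`. -/
theorem Real.rpow_tangent_le {x y b : ℝ} (hx : 0 < x) (hy : 0 < y) (hb : 1 ≤ b) :
    b * (x * y ^ (b - 1)) + (1 - b) * y ^ b ≤ x ^ b := by
  have h := one_add_mul_self_le_rpow_one_add (s := x / y - 1)
    (by linarith [div_pos hx hy]) hb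
  rw [show 1 + (x / y - 1) = x / y by ring, Real.div_rpow hx.le hy.le,
    le_div_iff₀ (Real.rpow_pos_of_pos hy b)] at h
  refine le_of_eq_of_le ?_ h
  rw [Real.rpow_sub hy, Real.rpow_one]
  field_simp
  ring

/-- Klein's inequality for the power functions. -/
theorem Matrix.PosDef.klein_rpow {X Y : Matrix n n ℂ} (hX : X.PosDef) (hY : Y.PosDef) {b : ℝ}
    (hb : 1 ≤ b) :
    b * (X * cfc (fun y : ℝ => y ^ (b - 1)) Y).trace.re +
      (1 - b) * (cfc (fun y : ℝ => y ^ b) Y).trace.re ≤ (cfc (fun x : ℝ => x ^ b) X).trace.re := by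
  rw [← kernelForm_one_id_left hX.isHermitian hY.isHermitian,
    ← kernelForm_one_right hX.isHermitian hY.isHermitian,
    ← kernelForm_one_left hX.isHermitian hY.isHermitian, ← kernelForm_const_mul,
    ← kernelForm_const_mul, ← kernelForm_add]
  exact kernelForm_mono _ _ (fun i j =>
    Real.rpow_tangent_le (hX.eigenvalues_pos i) (hY.eigenvalues_pos j) hb) _

theorem Matrix.PosDef.mul_cfc {X : Matrix n n ℂ} (hX : X.PosDef) (f : ℝ → ℝ) :
    X * cfc f X = cfc (fun x => x * f x) X := by
  have hX' : IsSelfAdjoint X := hX.isHermitian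
  rw [cfc_mul (fun x => x) f X (X.continuousOn_spectrum _) (X.continuousOn_spectrum _),
    cfc_id' ℝ X]

/-- Klein's inequality bounds both `W₁` and `W₂` from the tangent at `W`; the weighted sum collapses
there. -/
theorem Matrix.PosDef.trace_rpow_convex {W₁ W₂ W : Matrix n n ℂ} (hW₁ : W₁.PosDef)
    (hW₂ : W₂.PosDef) (hW : W.PosDef) {c₁ c₂ : ℝ} (h₁ : 0 ≤ c₁) (h₂ : 0 ≤ c₂) (h : c₁ + c₂ = 1)
    (e : W = c₁ • W₁ + c₂ • W₂) {b : ℝ} (hb : 1 ≤ b) :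
    (cfc (fun x : ℝ => x ^ b) W).trace.re ≤ c₁ * (cfc (fun x : ℝ => x ^ b) W₁).trace.re +
      c₂ * (cfc (fun x : ℝ => x ^ b) W₂).trace.re := by
  have k₁ := mul_le_mul_of_nonneg_left (hW₁.klein_rpow hW hb) h₁
  have k₂ := mul_le_mul_of_nonneg_left (hW₂.klein_rpow hW hb) h₂
  have k : (cfc (fun x : ℝ => x ^ b) W).trace.re =
      c₁ * (W₁ * cfc (fun y : ℝ => y ^ (b - 1)) W).trace.re +
      c₂ * (W₂ * cfc (fun y : ℝ => y ^ (b - 1)) W).trace.re := by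
    have : cfc (fun x : ℝ => x ^ b) W = W * cfc (fun y : ℝ => y ^ (b - 1)) W := by
      rw [hW.mul_cfc]
      refine cfc_congr fun x hx => ?_
      have := hW.spectrum_pos hx
      rw [Real.rpow_sub this, Real.rpow_one]
      field_simp
    rw [this]
    nth_rewrite 1 [e]
    simp only [Matrix.add_mul, Matrix.smul_mul, Matrix.trace_add, Matrix.trace_smul, Complex.add_re,
      Complex.smul_re, smul_eq_mul]
  obtain rfl : c₂ = 1 - c₁ := by linarith
  linear_combination k₁ + k₂ + b * k

/-- Weighted AM–GM for `x y^(1-s)` and `y^b`; the relation defining `b` cancels the powers of `y` in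
the geometric mean. -/
theorem Matrix.PosDef.trace_rpow_le {X W : Matrix n n ℂ} (hX : X.PosDef) (hW : W.PosDef)
    {s t b : ℝ} (ht₀ : 0 ≤ t) (ht₁ : t ≤ 1) (hb : (1 - t) * b = t * (s - 1)) :
    (cfc (fun x : ℝ => x ^ t) X).trace.re ≤
      t * (X * cfc (fun y : ℝ => y ^ (1 - s)) W).trace.re +
        (1 - t) * (cfc (fun y : ℝ => y ^ b) W).trace.re := by
  rw [← kernelForm_one_id_left hX.isHermitian hW.isHermitian,
    ← kernelForm_one_right hX.isHermitian hW.isHermitian,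
    ← kernelForm_one_left hX.isHermitian hW.isHermitian, ← kernelForm_const_mul,
    ← kernelForm_const_mul, ← kernelForm_add]
  refine kernelForm_mono _ _ (fun i j => ?_) _
  have hx := hX.eigenvalues_pos i
  have hy := hW.eigenvalues_pos j
  set x := hX.isHermitian.eigenvalues i
  set y := hW.isHermitian.eigenvalues j
  refine le_of_eq_of_le ?_ (Real.geom_mean_le_arith_mean2_weighted ht₀ (sub_nonneg.2 ht₁)
    (p₁ := x * y ^ (1 - s)) (p₂ := y ^ b) (by positivity) (by positivity) (by ring))
  rw [Real.mul_rpow hx.le (by positivity), ← Real.rpow_mul hy.le, ← Real.rpow_mul hy.le, mul_assoc,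
    ← Real.rpow_add hy, show (1 - s) * t + b * (1 - t) = 0 by linarith, Real.rpow_zero, mul_one]

theorem Matrix.PosDef.exists_trace_rpow_eq {X : Matrix n n ℂ} (hX : X.PosDef)
    {s t b : ℝ} (hs : 1 < s) (hb : (1 - t) * b = t * (s - 1)) :
    ∃ W : Matrix n n ℂ, W.PosDef ∧ (cfc (fun x : ℝ => x ^ t) X).trace.re =
      t * (X * cfc (fun y : ℝ => y ^ (1 - s)) W).trace.re +
        (1 - t) * (cfc (fun y : ℝ => y ^ b) W).trace.re := by
  have hs' : s - 1 ≠ 0 := by linarith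
  have hX' : IsSelfAdjoint X := hX.isHermitian
  -- Equality in AM–GM: with `y = x^((1-t)/(s-1))` both means' arguments equal `x^t`.
  refine ⟨cfc (fun x : ℝ => x ^ ((1 - t) / (s - 1))) X, Matrix.posDef_cfc hX.isHermitian
    fun x hx => Real.rpow_pos_of_pos (hX.spectrum_pos hx) _, ?_⟩
  have key : ∀ d : ℝ, cfc (fun y : ℝ => y ^ d) (cfc (fun x : ℝ => x ^ ((1 - t) / (s - 1))) X) =
      cfc (fun x : ℝ => x ^ ((1 - t) / (s - 1) * d)) X := by
    intro d
    rw [← cfc_comp' (fun y : ℝ => y ^ d) (fun x : ℝ => x ^ ((1 - t) / (s - 1))) X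
      ((X.finite_real_spectrum.image _).continuousOn _) (X.continuousOn_spectrum _)]
    exact cfc_congr fun x hx => (Real.rpow_mul (hX.spectrum_pos hx).le _ _).symm
  rw [key, key, hX.mul_cfc]
  have e1 : cfc (fun x : ℝ => x * x ^ ((1 - t) / (s - 1) * (1 - s))) X =
      cfc (fun x : ℝ => x ^ t) X := by
    refine cfc_congr fun x hx => ?_
    have hx := hX.spectrum_pos hx
    nth_rewrite 1 [← Real.rpow_one x]
    rw [← Real.rpow_add hx]
    congr 1
    field_simp
    ring
  have e2 : (1 - t) / (s - 1) * b = t := by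
    rw [div_mul_eq_mul_div, hb, mul_div_assoc, div_self hs', mul_one]
  rw [e1, e2]
  ring

/-! ### The Carlen–Lieb type theorem. -/

theorem Matrix.posSemidef_cfc_rpow {A : Matrix m m ℂ} (hA : A.PosDef) (s : ℝ) :
    (cfc (fun x : ℝ => x ^ s) A).PosSemidef :=
  (Matrix.posDef_cfc hA.isHermitian fun _ hx =>
    Real.rpow_pos_of_pos (hA.spectrum_pos hx) _).posSemidef

theorem trace_conj_rpow_mul_rpow_convex {s : ℝ} (hs : s ∈ Set.Icc (1 : ℝ) 2) (K : Matrix m n ℂ)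
    {A₁ A₂ A : Matrix m m ℂ} {W₁ W₂ W : Matrix n n ℂ} (hA₁ : A₁.PosDef)
    (hA₂ : A₂.PosDef) (hA : A.PosDef) (hW₁ : W₁.PosDef) (hW₂ : W₂.PosDef) (hW : W.PosDef)
    {c₁ c₂ : ℝ} (h₁ : 0 ≤ c₁) (h₂ : 0 ≤ c₂) (eA : A = c₁ • A₁ + c₂ • A₂)
    (eW : W = c₁ • W₁ + c₂ • W₂) :
    (Kᴴ * cfc (fun x : ℝ => x ^ s) A * K * cfc (fun y : ℝ => y ^ (1 - s)) W).trace.re ≤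
      c₁ * (Kᴴ * cfc (fun x : ℝ => x ^ s) A₁ * K * cfc (fun y : ℝ => y ^ (1 - s)) W₁).trace.re +
      c₂ * (Kᴴ * cfc (fun x : ℝ => x ^ s) A₂ * K * cfc (fun y : ℝ => y ^ (1 - s)) W₂).trace.re := by
  rw [← kernelForm_mul hA.isHermitian hW.isHermitian,
    ← kernelForm_mul hA₁.isHermitian hW₁.isHermitian,
    ← kernelForm_mul hA₂.isHermitian hW₂.isHermitian]
  exact kernelJointlyConvex_rpow hs K hA₁ hA₂ hA hW₁ hW₂ hW h₁ h₂ eA eW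

theorem cfc_rpow_one (s : ℝ) : cfc (fun x : ℝ => x ^ s) (1 : Matrix m m ℂ) = 1 := by
  rw [cfc_apply_one (R := ℝ)]
  simp

open scoped Matrix.Norms.L2Operator MatrixOrder in
-- Ando's theorem with `A = 1`, after factoring `C = D* D`.
theorem trace_mul_rpow_convex {s : ℝ} (hs : s ∈ Set.Icc (1 : ℝ) 2) {C : Matrix n n ℂ}
    (hC : C.PosSemidef) {W₁ W₂ W : Matrix n n ℂ} (hW₁ : W₁.PosDef) (hW₂ : W₂.PosDef)
    (hW : W.PosDef) {c₁ c₂ : ℝ} (h₁ : 0 ≤ c₁) (h₂ : 0 ≤ c₂) (h : c₁ + c₂ = 1)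
    (eW : W = c₁ • W₁ + c₂ • W₂) :
    (C * cfc (fun y : ℝ => y ^ (1 - s)) W).trace.re ≤
      c₁ * (C * cfc (fun y : ℝ => y ^ (1 - s)) W₁).trace.re +
      c₂ * (C * cfc (fun y : ℝ => y ^ (1 - s)) W₂).trace.re := by
  obtain ⟨D, rfl⟩ := CStarAlgebra.nonneg_iff_eq_star_mul_self.1 hC.nonneg
  rw [Matrix.star_eq_conjTranspose]
  have := trace_conj_rpow_mul_rpow_convex hs D (Matrix.PosDef.one) (Matrix.PosDef.one)
    (Matrix.PosDef.one) hW₁ hW₂ hW h₁ h₂ (by rw [← add_smul, h, one_smul]) eW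
  simpa only [cfc_rpow_one, Matrix.mul_one] using this

theorem trace_conj_rpow_convex {s : ℝ} (hs : s ∈ Set.Icc (1 : ℝ) 2) (K : Matrix m n ℂ)
    {A₁ A₂ A : Matrix m m ℂ} (hA₁ : A₁.PosDef) (hA₂ : A₂.PosDef) (hA : A.PosDef)
    {c₁ c₂ : ℝ} (h₁ : 0 ≤ c₁) (h₂ : 0 ≤ c₂) (h : c₁ + c₂ = 1) (eA : A = c₁ • A₁ + c₂ • A₂) :
    (Kᴴ * cfc (fun x : ℝ => x ^ s) A * K).trace.re ≤
      c₁ * (Kᴴ * cfc (fun x : ℝ => x ^ s) A₁ * K).trace.re +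
      c₂ * (Kᴴ * cfc (fun x : ℝ => x ^ s) A₂ * K).trace.re := by
  have := trace_conj_rpow_mul_rpow_convex hs K hA₁ hA₂ hA (Matrix.PosDef.one) (Matrix.PosDef.one)
    (Matrix.PosDef.one) h₁ h₂ eA (by rw [← add_smul, h, one_smul])
  simpa only [cfc_rpow_one, Matrix.mul_one] using this

theorem Matrix.PosDef.convexComb {A₁ A₂ : Matrix m m ℂ} (hA₁ : A₁.PosDef) (hA₂ : A₂.PosDef)
    {c₁ c₂ : ℝ} (h₁ : 0 ≤ c₁) (h₂ : 0 ≤ c₂) (h : c₁ + c₂ = 1) :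
    (c₁ • A₁ + c₂ • A₂).PosDef := by
  rcases h₁.eq_or_lt with rfl | h₁
  · obtain rfl : c₂ = 1 := by linarith
    simpa using hA₂
  · exact (hA₁.smul h₁).add_posSemidef (hA₂.posSemidef.smul h₂)

/-- A form of the Carlen–Lieb theorem: `A ↦ Tr (C + c • Kᴴ A ^ s K) ^ t` is convex for
`1 ≤ s ≤ 2` and `1 / s ≤ t ≤ 1`. -/
theorem trace_rpow_add_conj_rpow_convex {s t c : ℝ} (hs : s ∈ Set.Icc (1 : ℝ) 2)
    (ht : t ≤ 1) (hst : 1 ≤ t * s) (hc : 0 ≤ c) {C : Matrix n n ℂ} (hC : C.PosDef)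
    (K : Matrix m n ℂ) {A₁ A₂ : Matrix m m ℂ} (hA₁ : A₁.PosDef) (hA₂ : A₂.PosDef)
    {c₁ c₂ : ℝ} (h₁ : 0 ≤ c₁) (h₂ : 0 ≤ c₂) (h : c₁ + c₂ = 1) {X : Matrix m m ℂ → Matrix n n ℂ}
    (hX : ∀ A, X A = C + c • (Kᴴ * cfc (fun x : ℝ => x ^ s) A * K)) :
    (cfc (fun x : ℝ => x ^ t) (X (c₁ • A₁ + c₂ • A₂))).trace.re ≤
      c₁ * (cfc (fun x : ℝ => x ^ t) (X A₁)).trace.re +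
      c₂ * (cfc (fun x : ℝ => x ^ t) (X A₂)).trace.re := by
  have hA := hA₁.convexComb hA₂ h₁ h₂ h
  have hpos : ∀ {A : Matrix m m ℂ}, A.PosDef → (X A).PosDef := fun {A} hA => by
    rw [hX]
    exact hC.add_posSemidef (((Matrix.posSemidef_cfc_rpow hA s).conjTranspose_mul_mul_same K).smul hc)
  -- At `t = 1` the exponent `b` degenerates, but the trace is affine in `A^s`.
  rcases ht.eq_or_lt with rfl | ht
  · have e : ∀ {A : Matrix m m ℂ}, A.PosDef → (cfc (fun x : ℝ => x ^ (1 : ℝ)) (X A)).trace.re =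
        C.trace.re + c * (Kᴴ * cfc (fun x : ℝ => x ^ s) A * K).trace.re := fun {A} hA => by
      have : IsSelfAdjoint (X A) := (hpos hA).isHermitian
      simp only [Real.rpow_one]
      rw [cfc_id' ℝ (X A), hX, Matrix.trace_add, Matrix.trace_smul, Complex.add_re, Complex.smul_re,
        smul_eq_mul]
    rw [e hA, e hA₁, e hA₂]
    have := mul_le_mul_of_nonneg_left (trace_conj_rpow_convex hs K hA₁ hA₂ hA h₁ h₂ h rfl) hc
    linear_combination this + (-C.trace.re) * h
  have ht₀ : 0 < t := by
    by_contra! h0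
    nlinarith [hs.1]
  have hs₁ : 1 < s := by nlinarith [hs.1]
  obtain ⟨b, hb⟩ : ∃ b, (1 - t) * b = t * (s - 1) :=
    ⟨t * (s - 1) / (1 - t), by rw [mul_div_cancel₀]; linarith⟩
  -- `b ≥ 1` amounts to `t s ≥ 1`.
  have hb₁ : 1 ≤ b := by
    by_contra! h0
    nlinarith
  obtain ⟨W₁, hW₁, e₁⟩ := (hpos hA₁).exists_trace_rpow_eq hs₁ hb
  obtain ⟨W₂, hW₂, e₂⟩ := (hpos hA₂).exists_trace_rpow_eq hs₁ hb
  -- The combination of the two minimisers is only a competitor at the combined `A`, which suffices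
  -- for the upper bound.
  have hW := hW₁.convexComb hW₂ h₁ h₂ h
  rw [e₁, e₂]
  refine ((hpos hA).trace_rpow_le hW ht₀.le ht.le hb).trans ?_
  have k₁ := hW₁.trace_rpow_convex hW₂ hW h₁ h₂ h rfl hb₁
  have k₂ := trace_mul_rpow_convex hs hC.posSemidef hW₁ hW₂ hW h₁ h₂ h rfl
  have k₃ := trace_conj_rpow_mul_rpow_convex hs K hA₁ hA₂ hA hW₁ hW₂ hW h₁ h₂ rfl rfl
  simp only [hX, Matrix.add_mul, Matrix.smul_mul, Matrix.trace_add, Matrix.trace_smul,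
    Complex.add_re, Complex.smul_re, smul_eq_mul]
  have k₁' := mul_le_mul_of_nonneg_left k₁ (sub_nonneg.2 ht.le)
  have k₂' := mul_le_mul_of_nonneg_left k₂ ht₀.le
  have k₃' := mul_le_mul_of_nonneg_left k₃ (mul_nonneg ht₀.le hc)
  linear_combination k₁' + k₂' + k₃'

/-! ### Reduction from the deformed functions to powers. -/

open scoped Matrix.Norms.L2Operator MatrixOrder in
theorem IsContraction.one_sub_posSemidef {H : Matrix m n ℂ} (hH : IsContraction H) :
    (1 - Hᴴ * H).PosSemidef := by
  have hH : ‖H‖ ≤ 1 := hH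
  have h1 : ‖Hᴴ * H‖ ≤ 1 := by
    rw [Matrix.l2_opNorm_conjTranspose_mul_self]
    nlinarith [norm_nonneg H]
  have h2 : IsSelfAdjoint (Hᴴ * H) := Matrix.isHermitian_conjTranspose_mul_self H
  have h3 := h2.le_algebraMap_norm_self.trans
    (algebraMap_mono (Matrix n n ℂ) h1)
  rwa [map_one, Matrix.le_iff] at h3

theorem deformedExpArg_eq {q r : ℝ} (hr : 1 < r) (H : Matrix m n ℂ)
    (L : Matrix n n ℂ) {A : Matrix m m ℂ} (hA : A.IsHermitian) :
    (q - 1) • (L + Hᴴ * matrixLog r A * H) + 1 =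
      ((q - 1) • L + 1 - ((q - 1) / (r - 1)) • (Hᴴ * H)) +
        ((q - 1) / (r - 1)) • (Hᴴ * cfc (fun x : ℝ => x ^ (r - 1)) A * H) := by
  have hA' : IsSelfAdjoint A := hA
  have e : matrixLog r A = (1 / (r - 1)) • (cfc (fun x : ℝ => x ^ (r - 1)) A - 1) := by
    rw [← cfc_const_one ℝ A, ← cfc_sub _ _ A (A.continuousOn_spectrum _) (A.continuousOn_spectrum _),
      ← cfc_smul _ _ A (A.continuousOn_spectrum _), matrixLog]
    refine cfc_congr fun x _ => ?_
    simp only [deformedLog, hr.ne', if_false, smul_eq_mul]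
    ring
  rw [e]
  simp only [Matrix.mul_smul, Matrix.smul_mul, Matrix.mul_sub, Matrix.sub_mul, Matrix.mul_one,
    smul_add, smul_sub, smul_smul, mul_one_div]
  abel

theorem cfc_affine {q : ℝ} {Y : Matrix n n ℂ} (hY : Y.IsHermitian) :
    cfc (fun y : ℝ => y * (q - 1) + 1) Y = (q - 1) • Y + 1 := by
  have hY' : IsSelfAdjoint Y := hY
  rw [cfc_add _ _ _ (Y.continuousOn_spectrum _) (Y.continuousOn_spectrum _), cfc_const_one ℝ Y]
  simp only [mul_comm _ (q - 1)]
  rw [cfc_const_mul _ _ _ (Y.continuousOn_spectrum _), cfc_id' ℝ Y]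

theorem matrixExp_eq {q : ℝ} (hq : 1 < q) {Y : Matrix n n ℂ} (hY : Y.IsHermitian) :
    matrixExp q Y = cfc (fun x : ℝ => x ^ (1 / (q - 1))) ((q - 1) • Y + 1) := by
  have hY' : IsSelfAdjoint Y := hY
  rw [← cfc_affine hY, ← cfc_comp' (fun x : ℝ => x ^ (1 / (q - 1))) (fun y : ℝ => y * (q - 1) + 1) Y
      ((Y.finite_real_spectrum.image _).continuousOn _) (Y.continuousOn_spectrum _), matrixExp]
  refine cfc_congr fun x _ => ?_
  simp only [deformedExp, hq.ne', if_false]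

end

theorem proposition2p8 {m n : Type*} [Fintype m] [DecidableEq m] [Fintype n] [DecidableEq n]
    (H : Matrix m n ℂ) (hH : IsContraction H)
    (L : Matrix n n ℂ) (hL : L.PosDef)
    (q r : ℝ) (hq : q ∈ Set.Icc (2 : ℝ) 3) (hr : r ∈ Set.Icc (2 : ℝ) 3) (hqr : q ≤ r) :
    -- the deformed exponential is well defined at `L + H* log_r(A) H` for all `A > 0`
    (∀ A : Matrix m m ℂ, A.PosDef →
      (L + Hᴴ * matrixLog r A * H).IsHermitian ∧
        spectrum ℝ (L + Hᴴ * matrixLog r A * H) ⊆ deformedExpDomain q) ∧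
    ConvexOn ℝ {A : Matrix m m ℂ | A.PosDef}
      (fun A => (matrixExp q (L + Hᴴ * matrixLog r A * H)).trace.re) := by
  have hp : 0 < q - 1 := by linarith [hq.1]
  have hs : 0 < r - 1 := by linarith [hr.1]
  have hq₁ : 1 < q := by linarith
  have hr₁ : 1 < r := by linarith
  have hc : 0 ≤ (q - 1) / (r - 1) := by positivity
  have hc₁ : (q - 1) / (r - 1) ≤ 1 := (div_le_one hs).2 (by linarith)
  have hC : ((q - 1) • L + 1 - ((q - 1) / (r - 1)) • (Hᴴ * H)).PosDef := by
    -- Each summand has a sign: `L > 0`, `H*H ≤ 1` and `c ≤ 1`.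
    have : (q - 1) • L + 1 - ((q - 1) / (r - 1)) • (Hᴴ * H) =
        (q - 1) • L + ((1 - Hᴴ * H) + (1 - (q - 1) / (r - 1)) • (Hᴴ * H)) := by
      module
    rw [this]
    exact (hL.smul hp).add_posSemidef (hH.one_sub_posSemidef.add
      ((Matrix.posSemidef_conjTranspose_mul_self H).smul (sub_nonneg.2 hc₁)))
  have hY : ∀ A : Matrix m m ℂ, A.PosDef → (L + Hᴴ * matrixLog r A * H).IsHermitian := fun A _ =>
    hL.isHermitian.add (Matrix.isHermitian_conjTranspose_mul_mul H
      (cfc_predicate (deformedLog r) A : IsSelfAdjoint (matrixLog r A)))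
  refine ⟨fun A hA => ⟨hY A hA, fun x hx => ⟨fun _ => ?_, fun h => absurd h hq₁.not_gt⟩⟩,
    fun A₁ hA₁ A₂ hA₂ c₁ c₂ h₁ h₂ h => hA₁.convexComb hA₂ h₁ h₂ h,
    fun A₁ hA₁ A₂ hA₂ c₁ c₂ h₁ h₂ h => ?_⟩
  · have hX : ((q - 1) • (L + Hᴴ * matrixLog r A * H) + 1).PosDef := by
      rw [deformedExpArg_eq hr₁ H L hA.isHermitian]
      exact hC.add_posSemidef
        (((Matrix.posSemidef_cfc_rpow hA _).conjTranspose_mul_mul_same H).smul hc)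
    rw [← cfc_affine (hY A hA)] at hX
    have hx' : x * (q - 1) + 1 ∈
        spectrum ℝ (cfc (fun y : ℝ => y * (q - 1) + 1) (L + Hᴴ * matrixLog r A * H)) := by
      have hY' : IsSelfAdjoint (L + Hᴴ * matrixLog r A * H) := hY A hA
      rw [cfc_map_spectrum _ _ hY' (Matrix.continuousOn_spectrum _ _)]
      exact ⟨x, hx, rfl⟩
    rw [div_lt_iff₀ hp]
    linarith [hX.spectrum_pos hx']
  · have hA₁ : A₁.PosDef := hA₁
    have hA₂ : A₂.PosDef := hA₂
    have hA := hA₁.convexComb hA₂ h₁ h₂ h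
    simp only [smul_eq_mul]
    rw [matrixExp_eq hq₁ (hY _ hA), matrixExp_eq hq₁ (hY _ hA₁), matrixExp_eq hq₁ (hY _ hA₂),
      deformedExpArg_eq hr₁ H L hA.isHermitian, deformedExpArg_eq hr₁ H L hA₁.isHermitian,
      deformedExpArg_eq hr₁ H L hA₂.isHermitian]
    refine trace_rpow_add_conj_rpow_convex (s := r - 1) (t := 1 / (q - 1))
      ⟨by linarith [hr.1], by linarith [hr.2]⟩ ((div_le_one hp).2 (by linarith [hq.1])) ?_ hc hC H
      hA₁ hA₂ h₁ h₂ h (X := fun A => _ + _) (fun A => rfl)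
    -- The condition `t s ≥ 1` reads `(r - 1) / (q - 1) ≥ 1`, that is `q ≤ r`.
    rw [one_div_mul_eq_div, le_div_iff₀ hp]
    linarith
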